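/- Let $\mathsf{Q}$ be Robinson arithmetic in the language $\{0,\mathrm{S},+,\times\}$ with the axioms $\mathsf{Q}_1$: $\forall x y\,[x\neq y\to \mathrm{S}x\neq \mathrm{S}y]$; $\mathsf{Q}_2$: $\forall x\,[\mathrm{S}x\neq 0]$; $\mathsf{Q}_3$: $\forall x\,[x=0\vee\exists y\,[x=\mathrm{S}y]]$; $\mathsf{Q}_4$: $\forall x\,[x+0=x]$; $\mathsf{Q}_5$: $\forall x y\,[x+\mathrm{S}y=\mathrm{S}(x+y)]$; $\mathsf{Q}_6$: $\forall x\,[x\times 0=0]$; $\mathsf{Q}_7$: $\forall x y\,[x\times\mathrm{S}y=x\times y+x]$. For $n\in\mathbb{N}$ let $\overline{n}$ be the numeral $\mathrm{S}\cdots\mathrm{S}0$ with $n$ occurrences of $\mathrm{S}$. Let $\mathsf{IQ}$ be the first-order theory in the language $\{0,\mathrm{S},+,\times,\leq\}$, where $\leq$ is a fresh binary relation symbol, obtained from $\mathsf{Q}$ by replacing the axiom $\mathsf{Q}_3$ with the axiom schema $$\forall x\,\Big[x\leq\overline{n}\;\leftrightarrow\;\bigvee_{k\leq n}x=\overline{k}\Big]\qquad(n\in\mathbb{N}).$$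 Let $\mathsf{IQ}^{*}$ be the first-order theory in the language $\{0,\mathrm{S},+,\times\}$ obtained from $\mathsf{Q}$ by replacing $\mathsf{Q}_3$ with the axiom schema $$\forall x\,\Big[\exists z\,[z+x=\overline{n}]\;\rightarrow\;\bigvee_{k\leq n}x=\overline{k}\Big]\qquad(n\in\mathbb{N}).$$ A theory $S$ is interpretable in a theory $T$ if there is a relative translation $\tau$ ($m$-dimensional for some $m\geq 1$, parameter-free, one-piece) from the language of $S$ to that of $T$, given by a domain formula $\delta(\vec{x})$, a formula for equality and for each relation symbol, and a formula $\psi_f(\vec{x}_1,\dots,\vec{x}_n,\vec{y})$ for each function symbol $f$ (constants being $0$-ary function symbols), all with exactly the indicated free variables, such that $T\vdash\exists\vec{x}\,\delta(\vec{x})$; $T\vdash\bigwedge_{i}\delta(\vec{x}_i)\to\exists!\,\vec{y}\,[\delta(\vec{y})\wedge\psi_f(\vec{x}_1,\dots,\vec{x}_n,\vec{y})]$ for each $f$; $T\vdash\phi^{\tau}$ for each non-logical axiom $\phi$ of $S$; and, if equality is not translated as equality, $T\vdash\phi^\tau$ for each equality axiom $\phi$. Here $T\vdash\phi$ means that $\phi$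 is a logical consequence of $T$ (equivalently, by the completeness theorem, derivable from $T$), and $\phi^\tau$ is the usual translation of $\phi$, with quantifiers relativized to $\delta$. Theorem. $\mathsf{IQ}$ and $\mathsf{IQ}^{*}$ are mutually interpretable: $\mathsf{IQ}$ is interpretable in $\mathsf{IQ}^{*}$, and $\mathsf{IQ}^{*}$ is interpretable in $\mathsf{IQ}$. -/

import Mathlib

open FirstOrder FirstOrder.Language

/-! ## Relative translations and interpretations

`L.Formula α` is the type of first-order formulas with free variables indexed by `α`, and
`T ⊨ᵇ φ` says that `T` entails (the universal closure of) `φ`. A tuple of `n` vectors of `m`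
variables is indexed by `Fin n × Fin m`: the variable `(i, j)` is the `j`-th entry of the
`i`-th vector. Constant symbols are function symbols of arity `0`. -/

/-- The data of a many-dimensional, parameter-free, one-piece relative translation from `L₁` to
`L₂`: a domain formula, a formula for equality, and a formula for each relation symbol and each
function symbol, with exactly the prescribed free variables. (For finite languages such data
are finite, so the induced map on formulas is automatically computable.) -/
structure RelTranslation (L₁ L₂ : FirstOrder.Language.{0, 0}) where
  /-- the dimension `m` -/
  dim : ℕ
  dim_pos : 0 < dim
  /-- the domain `δ(x₁, …, xₘ)` -/
  dom : L₂.Formula (Fin dim)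
  dom_free : dom.freeVarFinset = Finset.univ
  /-- the translation of the equality symbol -/
  eqv : L₂.Formula (Fin 2 × Fin dim)
  eqv_free : eqv.freeVarFinset = Finset.univ
  /-- the translation of the relation symbols -/
  rel : ∀ {n : ℕ}, L₁.Relations n → L₂.Formula (Fin n × Fin dim)
  rel_free : ∀ {n : ℕ} (R : L₁.Relations n), (rel R).freeVarFinset = Finset.univ
  /-- the translation of the function symbols; the right summand is the vector of the value -/
  func : ∀ {n : ℕ}, L₁.Functions n → L₂.Formula ((Fin n × Fin dim) ⊕ Fin dim)
  func_free : ∀ {n : ℕ} (f : L₁.Functions n), (func f).freeVarFinset = Finset.univ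

namespace RelTranslation

variable {L₁ L₂ : FirstOrder.Language.{0, 0}} (τ : RelTranslation L₁ L₂)

/-- `δ(x⃗)`, for a vector `x⃗` of variables. -/
def domAt {β : Type} (x : Fin τ.dim → β) : L₂.Formula β :=
  τ.dom.relabel x

/-- The formula `(t)^{τ, w⃗}`, which says that `w⃗` is a value of the term `t`. The variable `x`
of `t` becomes the vector of the variables `Sum.inl (x, j)`, and `w⃗` is the vector of the
variables `Sum.inr j`. -/
noncomputable def term {α : Type} :
    L₁.Term α → L₂.Formula ((α × Fin τ.dim) ⊕ Fin τ.dim)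
  | .var x =>
      Formula.iInf fun j : Fin τ.dim =>
        Term.equal (Term.var (Sum.inr j)) (Term.var (Sum.inl (x, j)))
  | .func (l := n) f ts =>
      Formula.iExs (Fin n × Fin τ.dim)
        ((Formula.iInf fun i : Fin n => τ.domAt fun j => Sum.inr (i, j)) ⊓
          (Formula.iInf fun i : Fin n =>
            (term (ts i)).relabel
              (Sum.elim (fun p => Sum.inl (Sum.inl p)) fun j => Sum.inr (i, j))) ⊓
          (τ.func f).relabel (Sum.elim Sum.inr fun j => Sum.inl (Sum.inr j)))

/-- The translation `∃ v⃗₁ … v⃗ₙ [⋀ δ(v⃗ᵢ) ∧ ⋀ (tᵢ)^{τ, v⃗ᵢ} ∧ ψ(v⃗₁, …, v⃗ₙ)]` of an atomic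
formula with arguments `t₁, …, tₙ`, where `ψ` translates its relation symbol. -/
noncomputable def atom {α : Type} {n : ℕ} (ψ : L₂.Formula (Fin n × Fin τ.dim))
    (ts : Fin n → L₁.Term α) : L₂.Formula (α × Fin τ.dim) :=
  Formula.iExs (Fin n × Fin τ.dim)
    ((Formula.iInf fun i : Fin n => τ.domAt fun j => Sum.inr (i, j)) ⊓
      (Formula.iInf fun i : Fin n =>
        (τ.term (ts i)).relabel (Sum.elim Sum.inl fun j => Sum.inr (i, j))) ⊓
      ψ.relabel Sum.inr)

/-- How the variables of the body of a quantified formula are read under the translated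
quantifier: the last bound variable becomes the newly quantified vector. -/
def unbind {α : Type} {n m : ℕ} :
    (α ⊕ Fin (n + 1)) × Fin m → ((α ⊕ Fin n) × Fin m) ⊕ Fin m
  | (Sum.inl a, j) => Sum.inl (Sum.inl a, j)
  | (Sum.inr i, j) =>
      Fin.lastCases (motive := fun _ => ((α ⊕ Fin n) × Fin m) ⊕ Fin m)
        (Sum.inr j) (fun k => Sum.inl (Sum.inr k, j)) i

/-- The translation `φ^τ` of a formula. The primitive connectives are `⊥`, `→` and `∀`; the other
ones are abbreviations and are translated accordingly. -/
noncomputable def formula {α : Type} :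
    ∀ {n : ℕ}, L₁.BoundedFormula α n → L₂.Formula ((α ⊕ Fin n) × Fin τ.dim)
  | _, .falsum => ⊥
  | _, .equal t₁ t₂ => τ.atom τ.eqv ![t₁, t₂]
  | _, .rel R ts => τ.atom (τ.rel R) ts
  | _, .imp φ ψ => (formula φ).imp (formula ψ)
  | _, .all φ =>
      Formula.iAlls (Fin τ.dim) ((τ.domAt Sum.inr).imp ((formula φ).relabel unbind))

/-- The translation of a sentence, as a sentence. -/
noncomputable def sentence (φ : L₁.Sentence) : L₂.Sentence :=
  (τ.formula φ).relabel fun p => p.1.elim id Fin.elim0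

/-- Equality is translated as (coordinatewise) equality. -/
def EqAsEq : Prop :=
  τ.eqv = Formula.iInf fun j : Fin τ.dim =>
    Term.equal (Term.var ((0 : Fin 2), j)) (Term.var ((1 : Fin 2), j))

end RelTranslation

/-- The equality axioms of the language `L`: equality is an equivalence relation and a congruence
for all function and relation symbols. -/
inductive EqAxiom (L : FirstOrder.Language.{0, 0}) : L.Sentence → Prop
  | refl : EqAxiom L (∀' (&0 =' &0))
  | symm : EqAxiom L (∀' ∀' ((&0 =' &1) ⟹ (&1 =' &0)))
  | trans : EqAxiom L (∀' ∀' ∀' ((&0 =' &1) ⟹ ((&1 =' &2) ⟹ (&0 =' &2))))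
  | func {n : ℕ} (f : L.Functions n) : EqAxiom L
      (Formula.iAlls (Fin n ⊕ Fin n)
        ((Formula.iInf fun i : Fin n =>
            Term.equal (Term.var (Sum.inr (Sum.inl i))) (Term.var (Sum.inr (Sum.inr i)))).imp
          (Term.equal (Term.func f fun i => Term.var (Sum.inr (Sum.inl i)))
            (Term.func f fun i => Term.var (Sum.inr (Sum.inr i))))))
  | rel {n : ℕ} (R : L.Relations n) : EqAxiom L
      (Formula.iAlls (Fin n ⊕ Fin n)
        ((Formula.iInf fun i : Fin n =>
            Term.equal (Term.var (Sum.inr (Sum.inl i))) (Term.var (Sum.inr (Sum.inr i)))).imp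
          ((R.formula fun i => Term.var (Sum.inr (Sum.inl i))).imp
            (R.formula fun i => Term.var (Sum.inr (Sum.inr i))))))

/-- `τ` is a relative interpretation of the theory `S` in the theory `T`. -/
structure RelTranslation.IsInterpretation {L₁ L₂ : FirstOrder.Language.{0, 0}} (τ : RelTranslation L₁ L₂)
    (S : L₁.Theory) (T : L₂.Theory) : Prop where
  /-- `T ⊢ ∃ x⃗ δ(x⃗)` -/
  dom_nonempty :
    T ⊨ᵇ (Formula.iExs (Fin τ.dim) (τ.domAt Sum.inr) : L₂.Formula Empty)
  /-- `T ⊢ ⋀ δ(x⃗ᵢ) → ∃! y⃗ [δ(y⃗) ∧ ψ_f(x⃗₁, …, x⃗ₙ, y⃗)]` -/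
  func_total : ∀ {n : ℕ} (f : L₁.Functions n),
    T ⊨ᵇ ((Formula.iInf fun i : Fin n => τ.domAt fun j => (i, j)).imp
      (Formula.iExsUnique (Fin τ.dim) (τ.domAt Sum.inr ⊓ τ.func f)) :
        L₂.Formula (Fin n × Fin τ.dim))
  /-- `T` proves the translations of the non-logical axioms of `S` -/
  axioms : ∀ φ ∈ S, T ⊨ᵇ τ.sentence φ
  /-- `T` proves the translations of the equality axioms, if equality is not translated as
  equality -/
  eq_axioms : ¬ τ.EqAsEq → ∀ φ, EqAxiom L₁ φ → T ⊨ᵇ τ.sentence φ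

/-- `S` is (relatively) interpretable in `T`. -/
def Interpretable {L₁ L₂ : FirstOrder.Language.{0, 0}} (S : L₁.Theory) (T : L₂.Theory) : Prop :=
  ∃ τ : RelTranslation L₁ L₂, τ.IsInterpretation S T

/-- `S` and `T` are mutually interpretable. -/
def MutuallyInterpretable {L₁ L₂ : FirstOrder.Language.{0, 0}} (S : L₁.Theory) (T : L₂.Theory) : Prop :=
  Interpretable S T ∧ Interpretable T S

/-! ## The arithmetical theories -/

/-- The function symbols `0`, `S`, `+`, `×` of arithmetic. -/
inductive ArithFunc : ℕ → Type
  | zero : ArithFunc 0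
  | succ : ArithFunc 1
  | add : ArithFunc 2
  | mul : ArithFunc 2

/-- A single binary relation symbol `≤`. -/
inductive LeRel : ℕ → Type
  | le : LeRel 2

/-- The language `{0, S, +, ×}` together with the relation symbols `R`. -/
abbrev arithWith (R : ℕ → Type) : FirstOrder.Language.{0, 0} := ⟨ArithFunc, R⟩

/-- The language `{0, S, +, ×}`. -/
abbrev arith : FirstOrder.Language.{0, 0} := arithWith fun _ => Empty

/-- The language `{0, S, +, ×, ≤}`. -/
abbrev arithLe : FirstOrder.Language.{0, 0} := arithWith LeRel

namespace Arith

variable {R : ℕ → Type} {α : Type}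

/-- the term `0` -/
def zero : (arithWith R).Term α := Term.func (L := arithWith R) ArithFunc.zero ![]

/-- the term `S t` -/
def succ (t : (arithWith R).Term α) : (arithWith R).Term α :=
  Term.func (L := arithWith R) ArithFunc.succ ![t]

/-- the term `t + s` -/
def add (t s : (arithWith R).Term α) : (arithWith R).Term α :=
  Term.func (L := arithWith R) ArithFunc.add ![t, s]

/-- the term `t × s` -/
def mul (t s : (arithWith R).Term α) : (arithWith R).Term α :=
  Term.func (L := arithWith R) ArithFunc.mul ![t, s]

/-- the atomic formula `t ≤ s` -/
def le {n : ℕ} (t s : arithLe.Term (α ⊕ Fin n)) : arithLe.BoundedFormula α n :=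
  BoundedFormula.rel (L := arithLe) LeRel.le ![t, s]

/-- the numeral of `n`: the term `S … S 0` with `n` occurrences of `S` -/
def numeral : ℕ → (arithWith R).Term α
  | 0 => zero
  | n + 1 => succ (numeral n)

/-- The axioms `Q₁`, `Q₂`, `Q₄`, `Q₅`, `Q₆`, `Q₇`, that is, those of Robinson arithmetic without
`Q₃`. -/
def robinsonMinus (R : ℕ → Type) : (arithWith R).Theory :=
  { ∀' ∀' (∼(&0 =' &1) ⟹ ∼(succ (&0) =' succ (&1))),
    ∀' ∼(succ (&0) =' zero),
    ∀' (add (&0) zero =' &0),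
    ∀' ∀' (add (&0) (succ (&1)) =' succ (add (&0) (&1))),
    ∀' (mul (&0) zero =' zero),
    ∀' ∀' (mul (&0) (succ (&1)) =' add (mul (&0) (&1)) (&0)) }

/-- the formula `⋁_{k ≤ n} x = k̄`, where `x` is the bound variable of index `0` -/
noncomputable def isLeNumeral (n : ℕ) : (arithWith R).BoundedFormula Empty 1 :=
  BoundedFormula.iSup fun k : Fin (n + 1) => (&0 =' numeral k)

end Arith

open Arith in
/-- The theory `IQ`: the axiom `Q₃` of `Q` is replaced with the schema
`∀ x [x ≤ n̄ ↔ ⋁_{k ≤ n} x = k̄]`. -/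
noncomputable def theoryIQ : arithLe.Theory :=
  robinsonMinus LeRel ∪
    Set.range fun n : ℕ => ∀' (le (&0) (numeral n) ⇔ isLeNumeral n)

open Arith in
/-- The theory `IQ*`: the axiom `Q₃` of `Q` is replaced with the schema
`∀ x [∃ z (z + x = n̄) → ⋁_{k ≤ n} x = k̄]`. -/
noncomputable def theoryIQStar : arith.Theory :=
  robinsonMinus (fun _ => Empty) ∪
    Set.range fun n : ℕ => ∀' ((∃' (add (&1) (&0) =' numeral n)) ⟹ isLeNumeral n)

/-! Both interpretations are one-dimensional, keep equality and the arithmetical operations, and are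
built semantically: it is enough to define a model of one theory uniformly inside each model of the
other. To interpret `theoryIQ` in `theoryIQStar`, keep the domain and read `x ≤ y` as `∃ z, z + x =
y`; the missing half of the schema is `(n - k) + k = n` on numerals (`num_add`). Conversely, the
schema of `theoryIQ` controls `≤` only below numerals, so the order properties needed elsewhere
become hypotheses. `OrderGood` collects such properties; they hold at numerals and pass from `S u`
to `u`. Hence `SummandLe`, "`y ≤ x + y` whenever `x + y` is good", contains zero and is closed under
successor. If such a `y` satisfies `x + y = n`, then `y ≤ n`, so `y` is a numeral up to `n`.
Solovay's shortening of cuts then gives a definable subset of `SummandLe` closed under all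
operations; the remaining axioms are universal, so they are inherited. -/

namespace RelTranslation

/-! ### Translations and definable inner models -/

variable {L₁ L₂ : FirstOrder.Language.{0, 0}}

/-- `e` identifies the `L₁`-structure `N` with the structure that the translation `τ` defines
inside of the `L₂`-structure `M`. -/
structure IsInnerModel (τ : RelTranslation L₁ L₂) {M N : Type*} [L₂.Structure M] [L₁.Structure N]
    (e : N → Fin τ.dim → M) : Prop where
  dom_iff : ∀ v, τ.dom.Realize v ↔ ∃ x, e x = v
  eqv_iff : ∀ x : Fin 2 → N, τ.eqv.Realize (fun p => e (x p.1) p.2) ↔ x 0 = x 1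
  rel_iff : ∀ {n : ℕ} (R : L₁.Relations n) (x : Fin n → N),
    (τ.rel R).Realize (fun p => e (x p.1) p.2) ↔ Structure.RelMap R x
  func_iff : ∀ {n : ℕ} (f : L₁.Functions n) (x : Fin n → N) (y : N),
    (τ.func f).Realize (Sum.elim (fun p => e (x p.1) p.2) (e y)) ↔ y = Structure.funMap f x

namespace IsInnerModel

variable {τ : RelTranslation L₁ L₂} {M N : Type*} [L₂.Structure M] [L₁.Structure N]
  {e : N → Fin τ.dim → M}

/-- This turns the relativized existential blocks in `term` and `atom` into quantifiers over `N`. -/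
theorem exists_vectors (h : τ.IsInnerModel e) {n : ℕ} {P : (Fin n × Fin τ.dim → M) → Prop} :
    (∃ v : Fin n × Fin τ.dim → M, (∀ i, τ.dom.Realize fun j => v (i, j)) ∧ P v) ↔
      ∃ y : Fin n → N, P fun p => e (y p.1) p.2 := by
  constructor
  · rintro ⟨v, hv, hP⟩
    simp only [h.dom_iff] at hv
    choose y hy using hv
    refine ⟨y, ?_⟩
    convert hP using 2 with p
    rw [hy]
  · rintro ⟨y, hy⟩
    exact ⟨_, fun i => (h.dom_iff _).2 ⟨y i, rfl⟩, hy⟩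

/-- Injectivity of `e` matters at variables, where coordinatewise equality in `M` must reflect
equality in `N`. The value `y` varies in the induction because the values of subterms are bound. -/
theorem realize_term (h : τ.IsInnerModel e) (he : Function.Injective e) {α : Type}
    (t : L₁.Term α) (x : α → N) (y : N) :
    (τ.term t).Realize (Sum.elim (fun p => e (x p.1) p.2) (e y)) ↔ y = t.realize x := by
  induction t generalizing y with
  | var a =>
    simp only [term, Formula.realize_iInf, Formula.realize_equal, Term.realize_var,
      Sum.elim_inl, Sum.elim_inr, ← funext_iff]
    exact he.eq_iff
  | @func n f ts ih =>
    simp only [term, Formula.realize_iExs, Formula.realize_inf, Formula.realize_iInf, domAt,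
      Formula.realize_relabel, and_assoc]
    refine h.exists_vectors.trans ?_
    have key : ∀ (w : Fin n × Fin τ.dim → M) i, (τ.term (ts i)).Realize
        (Sum.elim (Sum.elim (fun p => e (x p.1) p.2) (e y)) w ∘
          Sum.elim (fun p => Sum.inl (Sum.inl p)) fun j => Sum.inr (i, j)) ↔
        (τ.term (ts i)).Realize (Sum.elim (fun p => e (x p.1) p.2) fun j => w (i, j)) := by
      intro w i
      refine iff_of_eq (congrArg _ ?_)
      funext q
      rcases q with q | q <;> rfl
    have key' : ∀ w : Fin n × Fin τ.dim → M, (Sum.elim (Sum.elim (fun p : _ × _ => e (x p.1) p.2) (e y)) w ∘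
          Sum.elim Sum.inr fun j => Sum.inl (Sum.inr j)) = Sum.elim w (e y) := by
      intro w
      funext q
      rcases q with q | q <;> rfl
    simp only [key, key', ih, h.func_iff, Term.realize_func]
    constructor
    · rintro ⟨z, hz, rfl⟩
      rw [funext hz]
    · rintro rfl
      exact ⟨_, fun _ => rfl, rfl⟩

theorem realize_atom (h : τ.IsInnerModel e) (he : Function.Injective e) {α : Type} {n : ℕ}
    (ψ : L₂.Formula (Fin n × Fin τ.dim)) (ts : Fin n → L₁.Term α) (x : α → N) :
    (τ.atom ψ ts).Realize (fun p => e (x p.1) p.2) ↔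
      ψ.Realize (fun p => e ((ts p.1).realize x) p.2) := by
  simp only [atom, Formula.realize_iExs, Formula.realize_inf, Formula.realize_iInf, domAt,
    Formula.realize_relabel, and_assoc]
  refine h.exists_vectors.trans ?_
  have key : ∀ (w : _ → M) i, (τ.term (ts i)).Realize
      (Sum.elim (fun p => e (x p.1) p.2) w ∘ Sum.elim Sum.inl fun j => Sum.inr (i, j)) ↔
      (τ.term (ts i)).Realize (Sum.elim (fun p => e (x p.1) p.2) fun j => w (i, j)) := by
    intro w i
    refine iff_of_eq (congrArg _ ?_)
    funext q
    rcases q with q | q <;> rfl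
  simp only [key, h.realize_term he, Sum.elim_comp_inr]
  constructor
  · rintro ⟨z, hz, hψ⟩
    rwa [funext hz] at hψ
  · intro hψ
    exact ⟨_, fun _ => rfl, hψ⟩

theorem realize_formula (h : τ.IsInnerModel e) (he : Function.Injective e) {α : Type} {n : ℕ}
    (φ : L₁.BoundedFormula α n) (x : α → N) (xs : Fin n → N) :
    (τ.formula φ).Realize (fun p => e (Sum.elim x xs p.1) p.2) ↔ φ.Realize x xs := by
  induction φ with
  | falsum => exact Iff.rfl
  | equal t₁ t₂ =>
    simp only [formula, h.realize_atom he]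
    exact h.eqv_iff fun i => (![t₁, t₂] i).realize (Sum.elim x xs)
  | rel R ts =>
    simp only [formula, h.realize_atom he]
    exact h.rel_iff R fun i => (ts i).realize (Sum.elim x xs)
  | imp φ ψ ihφ ihψ =>
    simp only [formula, Formula.realize_imp, BoundedFormula.realize_imp, ihφ, ihψ]
  | all φ ih =>
    simp only [formula, Formula.realize_iAlls, Formula.realize_imp, domAt, Formula.realize_relabel,
      BoundedFormula.realize_all]
    have key : ∀ y : N, ((fun a => Sum.elim (fun p => e (Sum.elim x xs p.1) p.2) (e y) a) ∘
        unbind : _ → M) = fun p => e (Sum.elim x (Fin.snoc xs y : Fin _ → N) p.1) p.2 := by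
      intro y
      funext ⟨q, j⟩
      rcases q with q | q
      · rfl
      · refine Fin.lastCases ?_ (fun k => ?_) q <;> simp [unbind]
    constructor
    · intro H y
      rw [← ih, ← key]
      exact H (e y) ((h.dom_iff _).2 ⟨y, rfl⟩)
    · intro H v hv
      obtain ⟨y, hy⟩ := (h.dom_iff _).1 hv
      obtain rfl : e y = v := hy
      rw [key, ih]
      exact H y

theorem realize_sentence (h : τ.IsInnerModel e) (he : Function.Injective e) (φ : L₁.Sentence) :
    M ⊨ τ.sentence φ ↔ N ⊨ φ := by
  rw [Sentence.Realize, sentence, Formula.realize_relabel, Sentence.Realize]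
  refine Iff.trans (iff_of_eq (congrArg _ ?_)) (h.realize_formula he φ default default)
  funext ⟨q, j⟩
  rcases q with q | q
  · exact q.elim
  · exact q.elim0

end IsInnerModel

/-- A translation of equality as equality that defines a model of `S` inside of every model of `T`
is an interpretation. -/
theorem isInterpretation_of_isInnerModel {τ : RelTranslation L₁ L₂} {S : L₁.Theory}
    {T : L₂.Theory} (hτ : τ.EqAsEq)
    (H : ∀ (M : Type) [L₂.Structure M] [Nonempty M], M ⊨ T →
      ∃ (N : Type) (_ : L₁.Structure N) (_ : Nonempty N) (e : N → Fin τ.dim → M),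
        Function.Injective e ∧ τ.IsInnerModel e ∧ N ⊨ S) :
    τ.IsInterpretation S T where
  dom_nonempty M v xs := by
    obtain ⟨N, _, ⟨x⟩, e, he, h, -⟩ := H M M.is_model
    rw [BoundedFormula.realize_iExs]
    refine ⟨e x, ?_⟩
    rw [domAt, Formula.realize_relabel]
    exact (h.dom_iff _).2 ⟨x, rfl⟩
  func_total f M v xs := by
    obtain ⟨N, _, -, e, he, h, -⟩ := H M M.is_model
    rw [BoundedFormula.realize_imp]
    intro hv
    have hv' : ∀ i, ∃ x, e x = fun j => v (i, j) := by
      intro i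
      have := (Formula.realize_iInf (M := M) (v := v)).1 (Formula.boundedFormula_realize_eq_realize _ _ _ |>.1 hv) i
      rw [domAt, Formula.realize_relabel] at this
      exact (h.dom_iff _).1 this
    choose x hx using hv'
    -- All argument vectors lie in the domain, so the assignment may be taken to come from `N`.
    obtain rfl : (fun p => e (x p.1) p.2) = v := by
      funext p
      rw [hx]
    rw [BoundedFormula.realize_iExsUnique]
    simp only [Formula.realize_inf, domAt, Formula.realize_relabel, Sum.elim_comp_inr]
    refine ⟨e (Structure.funMap f x), ⟨(h.dom_iff _).2 ⟨_, rfl⟩, (h.func_iff f x _).2 rfl⟩, ?_⟩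
    rintro w ⟨hw, hf⟩
    obtain ⟨y, rfl⟩ := (h.dom_iff _).1 hw
    rw [(h.func_iff f x _).1 hf]
  axioms φ hφ := by
    rw [Theory.models_sentence_iff]
    intro M
    obtain ⟨N, _, _, e, he, h, hN⟩ := H M M.is_model
    exact (h.realize_sentence he φ).2 (hN.realize_of_mem φ hφ)
  eq_axioms h := absurd hτ h

end RelTranslation

/-! ### Shortening an inductive set to a cut closed under addition and multiplication -/

/-- The axioms `Q₁`, `Q₂`, `Q₄`, `Q₅`, `Q₆`, `Q₇` for given operations. -/
structure RobinsonMinus {M : Type*} (z : M) (s : M → M) (a m : M → M → M) : Prop where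
  succ_inj : ∀ x y, s x = s y → x = y
  succ_ne_zero : ∀ x, s x ≠ z
  add_zero : ∀ x, a x z = x
  add_succ : ∀ x y, a x (s y) = s (a x y)
  mul_zero : ∀ x, m x z = z
  mul_succ : ∀ x y, m x (s y) = a (m x y) x

namespace RobinsonMinus

variable {M : Type*} {z : M} {s : M → M} {a m : M → M → M}

/-- Restricting to the right summands that associate and that preserve `I`. -/
structure AddCut (a : M → M → M) (I : M → Prop) (y : M) : Prop where
  mem : I y
  assoc : ∀ x w, a (a x w) y = a x (a w y)
  add_mem : ∀ x, I x → I (a x y)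

/-- Restricting to the right factors that left distribute and that preserve `I`. -/
structure DistribCut (a m : M → M → M) (I : M → Prop) (y : M) : Prop where
  mem : I y
  distrib : ∀ x w, I x → m x (a w y) = a (m x w) (m x y)
  mul_mem : ∀ x, I x → I (m x y)

/-- Restricting to the right factors that associate and that preserve `J`. -/
structure MulCut (m : M → M → M) (I J : M → Prop) (y : M) : Prop where
  mem : J y
  assoc : ∀ x w, I x → J w → m x (m w y) = m (m x w) y
  mul_mem : ∀ x, J x → J (m x y)

/-- `I` contains zero and is closed under successor. -/
structure Inductive (z : M) (s : M → M) (I : M → Prop) : Prop where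
  zero_mem : I z
  succ_mem : ∀ y, I y → I (s y)

variable (h : RobinsonMinus z s a m) {I J : M → Prop}
include h

theorem inductive_addCut (hI : Inductive z s I) : Inductive z s (AddCut a I) where
  zero_mem := ⟨hI.zero_mem, by simp [h.add_zero], by simp [h.add_zero]⟩
  succ_mem y hy := ⟨hI.succ_mem y hy.mem, by simp [h.add_succ, hy.assoc],
    fun x hx => by rw [h.add_succ]; exact hI.succ_mem _ (hy.add_mem x hx)⟩

omit h in
-- Associativity at `y'` makes adding `y + y'` the same as adding `y` and then `y'`, and each of
-- these steps preserves `I`.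
theorem AddCut.add {y y' : M} (hy : AddCut a I y) (hy' : AddCut a I y') :
    AddCut a I (a y y') where
  mem := hy'.add_mem _ hy.mem
  assoc x w := by rw [← hy'.assoc, hy.assoc, hy'.assoc, hy'.assoc]
  add_mem x hx := by rw [← hy'.assoc]; exact hy'.add_mem _ (hy.add_mem x hx)

/-- the cut of summands and left distributing factors -/
abbrev SemiCut (a m : M → M → M) (I : M → Prop) : M → Prop :=
  DistribCut a m (AddCut a I)

/-- the cut that is closed under all operations -/
abbrev Cut (a m : M → M → M) (I : M → Prop) : M → Prop :=
  MulCut m (AddCut a I) (SemiCut a m I)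

theorem inductive_semiCut (hI : Inductive z s I) : Inductive z s (SemiCut a m I) := by
  have h1 := h.inductive_addCut hI
  refine ⟨⟨h1.zero_mem, by simp [h.add_zero, h.mul_zero], fun x _ => by
    rw [h.mul_zero]; exact h1.zero_mem⟩, fun y hy => ⟨h1.succ_mem y hy.mem, ?_, ?_⟩⟩
  · intro x w hx
    -- Here `(x w + x y) + x` is rebracketed with `x` as right summand, which is why `DistribCut`
    -- asks `x` to lie in `AddCut`.
    rw [h.add_succ, h.mul_succ, h.mul_succ, hy.distrib x w hx, hx.assoc]
  · intro x hx
    rw [h.mul_succ]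
    exact (hy.mul_mem x hx).add hx

omit h in
theorem semiCut_add {y y' : M} (hy : SemiCut a m I y) (hy' : SemiCut a m I y') :
    SemiCut a m I (a y y') where
  mem := hy.mem.add hy'.mem
  distrib x w hx := by
    rw [← hy'.mem.assoc, hy'.distrib x _ hx, hy.distrib x _ hx, (hy'.mul_mem x hx).assoc,
      hy'.distrib x _ hx]
  mul_mem x hx := by
    rw [hy'.distrib x _ hx]
    exact (hy.mul_mem x hx).add (hy'.mul_mem x hx)

theorem inductive_cut (hI : Inductive z s I) : Inductive z s (Cut a m I) := by
  have h2 := h.inductive_semiCut hI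
  refine ⟨⟨h2.zero_mem, by simp [h.mul_zero], fun x _ => by
    rw [h.mul_zero]; exact h2.zero_mem⟩, fun y hy => ⟨h2.succ_mem y hy.mem, ?_, ?_⟩⟩
  · intro x w hx hw
    -- Expanding `x (w y + w)` needs distributivity at the right summand `w`, hence the restriction
    -- on `w` in `MulCut`.
    rw [h.mul_succ, hw.distrib x _ hx, hy.assoc x w hx hw, h.mul_succ]
  · intro x hx
    rw [h.mul_succ]
    exact semiCut_add (hy.mul_mem x hx) hx

omit h in
-- For associativity, `x (w y + w y')` is expanded using that `w y'` stays in `SemiCut`;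
-- distributivity at `y'` then recombines the sum, since `x w` stays in `SemiCut` as well.
theorem cut_add {y y' : M} (hy : Cut a m I y) (hy' : Cut a m I y') : Cut a m I (a y y') where
  mem := semiCut_add hy.mem hy'.mem
  assoc x w hx hw := by
    rw [hy'.mem.distrib w _ hw.mem, (hy'.mul_mem w hw).distrib x _ hx, hy.assoc x w hx hw,
      hy'.assoc x w hx hw, hy'.mem.distrib _ _ (hw.mul_mem x hx)]
  mul_mem x hx := by
    rw [hy'.mem.distrib x _ hx.mem]
    exact semiCut_add (hy.mul_mem x hx) (hy'.mul_mem x hx)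

omit h in
theorem cut_mul {y y' : M} (hy : Cut a m I y) (hy' : Cut a m I y') : Cut a m I (m y y') where
  mem := hy'.mul_mem _ hy.mem
  assoc x w hx hw := by
    rw [hy'.assoc w y hw.mem hy.mem, hy'.assoc x _ hx (hy.mul_mem w hw), hy.assoc x w hx hw,
      hy'.assoc _ y (hw.mul_mem x hx) hy.mem]
  mul_mem x hx := by
    rw [hy'.assoc x y hx.mem hy.mem]
    exact hy'.mul_mem _ (hy.mul_mem x hx)

/-- the numeral of `n` -/
def num (z : M) (s : M → M) (n : ℕ) : M := s^[n] z

omit h in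
@[simp] theorem num_succ (n : ℕ) : num z s (n + 1) = s (num z s n) :=
  Function.iterate_succ_apply' s n z

theorem num_add (k l : ℕ) : a (num z s k) (num z s l) = num z s (k + l) := by
  induction l with
  | zero => exact h.add_zero _
  | succ l ih => rw [num_succ, h.add_succ, ih, ← Nat.add_assoc, num_succ]

end RobinsonMinus

open RobinsonMinus

/-! ### Order conditions that force summands of numerals to be numerals -/

section Order

variable {M : Type*} {z : M} {s : M → M} {a m : M → M → M} {r : M → M → Prop}

/-- The local condition for the elements below `v` to look like the numbers up to `v`. -/
def OrderStep (z : M) (s : M → M) (r : M → M → Prop) (v : M) : Prop :=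
  r z v ∧ ∀ u, v = s u → r u v ∧ ∀ t, r t u → r t v ∧ r (s t) v

/-- The elements below `w` look like the numbers up to `w`. -/
def OrderGood (z : M) (s : M → M) (r : M → M → Prop) (w : M) : Prop :=
  OrderStep z s r w ∧ ∀ v, r v w → OrderStep z s r v

/-- The summand `y` lies below each of the well-behaved sums `x + y`. -/
def SummandLe (z : M) (s : M → M) (a : M → M → M) (r : M → M → Prop) (y : M) : Prop :=
  ∀ x, OrderGood z s r (a x y) → r y (a x y)

/-- The local condition at `s u` puts `u` and everything below `u` below `s u`; this stands in for
transitivity, which is not available. -/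
theorem OrderGood.of_succ {u : M} (hu : OrderGood z s r (s u)) : OrderGood z s r u :=
  have hs := hu.1.2 u rfl
  ⟨hu.2 u hs.1, fun v hv => hu.2 v (hs.2 v hv).1⟩

theorem inductive_summandLe (h : RobinsonMinus z s a m) : Inductive z s (SummandLe z s a r) where
  zero_mem _ hx := hx.1.1
  succ_mem y hy x hx := by
    rw [h.add_succ] at hx ⊢
    -- Goodness descends from `S (x + y)` to `x + y`, so `y ≤ x + y`; the local condition at `S (x +
    -- y)` lifts this to `S y ≤ S (x + y)`.
    exact ((hx.1.2 _ rfl).2 _ (hy x hx.of_succ)).2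

theorem orderGood_num (h : RobinsonMinus z s a m)
    (hr : ∀ n x, r x (num z s n) ↔ ∃ k ≤ n, x = num z s k) (n : ℕ) :
    OrderGood z s r (num z s n) := by
  have key : ∀ n, OrderStep z s r (num z s n) := by
    refine fun n => ⟨(hr n _).2 ⟨0, n.zero_le, rfl⟩, fun u hu => ?_⟩
    rcases n with _ | n
    · exact absurd hu.symm (h.succ_ne_zero u)
    · rw [num_succ] at hu
      -- Injectivity makes `u` a numeral, so the schema describes everything below it.
      obtain rfl := h.succ_inj _ _ hu
      refine ⟨(hr (n + 1) _).2 ⟨n, n.le_succ, rfl⟩, fun t ht => ?_⟩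
      obtain ⟨k, hk, rfl⟩ := (hr n t).1 ht
      exact ⟨(hr (n + 1) _).2 ⟨k, by lia, rfl⟩,
        (hr (n + 1) _).2 ⟨k + 1, by lia, (num_succ k).symm⟩⟩
  refine ⟨key n, fun v hv => ?_⟩
  obtain ⟨k, -, rfl⟩ := (hr n v).1 hv
  exact key k

theorem SummandLe.exists_num (h : RobinsonMinus z s a m)
    (hr : ∀ n x, r x (num z s n) ↔ ∃ k ≤ n, x = num z s k) {y : M}
    (hy : SummandLe z s a r y) {x : M} {n : ℕ} (hx : a x y = num z s n) :
    ∃ k ≤ n, y = num z s k := by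
  have := hy x
  rw [hx] at this
  exact (hr n y).1 (this (orderGood_num h hr n))

end Order

/-! ### Free variables of conjunctions and equations -/

section FreeVariables

variable {L : FirstOrder.Language.{0, 0}} {α : Type} [DecidableEq α]

theorem mem_freeVarFinset_foldr_inf {n : ℕ} (x : α) (l : List (L.BoundedFormula α n)) :
    x ∈ (l.foldr (· ⊓ ·) ⊤).freeVarFinset ↔ ∃ φ ∈ l, x ∈ φ.freeVarFinset := by
  induction l with
  | nil =>
    simp only [List.foldr_nil, List.not_mem_nil, false_and, exists_false, iff_false]
    change x ∉ (∅ ∪ ∅ : Finset α)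
    simp
  | cons φ l ih =>
    rw [List.foldr_cons]
    -- A conjunction unfolds to `(φ → ψ → ⊥) → ⊥`; each `⊥` contributes an empty set.
    change x ∈ (φ.freeVarFinset ∪ ((l.foldr (· ⊓ ·) ⊤).freeVarFinset ∪ ∅)) ∪ ∅ ↔ _
    simp [ih]

theorem mem_freeVarFinset_iInf {β : Type} [Finite β] (x : α) (f : β → L.Formula α) :
    x ∈ (Formula.iInf f).freeVarFinset ↔ ∃ b, x ∈ (f b).freeVarFinset := by
  rw [Formula.iInf, BoundedFormula.iInf, mem_freeVarFinset_foldr_inf]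
  simp

theorem mem_freeVarFinset_inf_right {x : α} (φ ψ : L.Formula α)
    (hx : x ∈ ψ.freeVarFinset) : x ∈ (φ ⊓ ψ).freeVarFinset := by
  change x ∈ (φ.freeVarFinset ∪ (ψ.freeVarFinset ∪ ∅)) ∪ ∅
  simp [hx]

theorem freeVarFinset_equal (t₁ t₂ : L.Term α) :
    (t₁.equal t₂).freeVarFinset = (t₁.relabel (Sum.inl : α → α ⊕ Fin 0)).varFinsetLeft ∪
      (t₂.relabel (Sum.inl : α → α ⊕ Fin 0)).varFinsetLeft := rfl

end FreeVariables

/-! ### Translations that keep the arithmetical operations -/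

/-- The one-dimensional translation of equality as equality and of the arithmetical operations
as themselves, for a given domain and given translations of the relation symbols. -/
noncomputable def arithTranslation {R₁ R₂ : ℕ → Type} (dom : (arithWith R₂).Formula (Fin 1))
    (dom_free : 0 ∈ dom.freeVarFinset)
    (rel : ∀ {n : ℕ}, R₁ n → (arithWith R₂).Formula (Fin n × Fin 1))
    (rel_free : ∀ {n : ℕ} (r : R₁ n), (rel r).freeVarFinset = Finset.univ) :
    RelTranslation (arithWith R₁) (arithWith R₂) where
  dim := 1
  dim_pos := one_pos
  dom := dom
  dom_free := by
    ext i
    rw [Subsingleton.elim i 0]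
    simpa using dom_free
  eqv := Formula.iInf fun j : Fin 1 =>
    Term.equal (Term.var ((0 : Fin 2), j)) (Term.var ((1 : Fin 2), j))
  eqv_free := by
    ext ⟨i, j⟩
    simp only [mem_freeVarFinset_iInf, freeVarFinset_equal, Finset.mem_univ, iff_true]
    refine ⟨j, ?_⟩
    fin_cases i <;> simp
  rel := rel
  rel_free := rel_free
  func {n} f := Term.equal (Term.func (L := arithWith R₂) f fun i => Term.var (Sum.inl (i, 0)))
    (Term.var (Sum.inr 0))
  func_free {n} f := by
    ext i
    rcases i with ⟨i, j⟩ | j <;> simp [freeVarFinset_equal, Subsingleton.elim j 0]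

theorem arithTranslation_eqAsEq {R₁ R₂ : ℕ → Type} (dom : (arithWith R₂).Formula (Fin 1))
    (dom_free : 0 ∈ dom.freeVarFinset)
    (rel : ∀ {n : ℕ}, R₁ n → (arithWith R₂).Formula (Fin n × Fin 1))
    (rel_free : ∀ {n : ℕ} (r : R₁ n), (rel r).freeVarFinset = Finset.univ) :
    (arithTranslation dom dom_free rel rel_free).EqAsEq := rfl

theorem arithTranslation_isInnerModel {R₁ R₂ : ℕ → Type} (dom : (arithWith R₂).Formula (Fin 1))
    (dom_free : 0 ∈ dom.freeVarFinset)
    (rel : ∀ {n : ℕ}, R₁ n → (arithWith R₂).Formula (Fin n × Fin 1))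
    (rel_free : ∀ {n : ℕ} (r : R₁ n), (rel r).freeVarFinset = Finset.univ)
    {M N : Type*} [(arithWith R₂).Structure M] [(arithWith R₁).Structure N] {e : N → M}
    (he : Function.Injective e) (hdom : ∀ v, dom.Realize v ↔ ∃ x, e x = v 0)
    (hrel : ∀ {n : ℕ} (r : R₁ n) (x : Fin n → N), (rel r).Realize (fun p => e (x p.1)) ↔
      Structure.RelMap (L := arithWith R₁) r x)
    (hfunc : ∀ {n : ℕ} (f : ArithFunc n) (x : Fin n → N),
      e (Structure.funMap (L := arithWith R₁) f x) =
        Structure.funMap (L := arithWith R₂) f fun i => e (x i)) :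
    (arithTranslation dom dom_free rel rel_free).IsInnerModel fun x (_ : Fin 1) => e x where
  dom_iff v := (hdom v).trans <| exists_congr fun x =>
    ⟨fun hx => funext <| Fin.forall_fin_one.2 hx, fun hx => congrFun hx (0 : Fin 1)⟩
  eqv_iff x := by
    have key (w : Fin 2 × Fin 1 → M) : (Formula.iInf fun j : Fin 1 =>
        (Term.var ((0 : Fin 2), j) : (arithWith R₂).Term _).equal
          (Term.var ((1 : Fin 2), j))).Realize w ↔ w (0, 0) = w (1, 0) := by
      simp [Formula.realize_iInf]
    exact (key _).trans he.eq_iff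
  rel_iff r x := hrel r x
  func_iff {n} f x y := by
    have key (w : Fin n × Fin 1 ⊕ Fin 1 → M) : (Term.equal
        (Term.func (L := arithWith R₂) f fun i => Term.var (Sum.inl (i, 0)))
        (Term.var (Sum.inr 0))).Realize w ↔
          Structure.funMap (L := arithWith R₂) f (fun i => w (Sum.inl (i, 0))) = w (Sum.inr 0) := by
      simp [Formula.realize_equal]
    refine (key _).trans ?_
    rw [eq_comm (a := y), ← he.eq_iff, hfunc f x]
    rfl

/-- The structure given by the arithmetical operations and by relations. -/
@[reducible] def arithStructure {R : ℕ → Type} {M : Type*} (z : M) (s : M → M) (a m : M → M → M)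
    (rel : ∀ {n : ℕ}, R n → (Fin n → M) → Prop) : (arithWith R).Structure M where
  funMap
    | .zero, _ => z
    | .succ, x => s (x 0)
    | .add, x => a (x 0) (x 1)
    | .mul, x => m (x 0) (x 1)
  RelMap := rel

/-! ### Semantics of the two theories -/

namespace Arith

section Operations

variable (R : ℕ → Type) {M : Type*} [(arithWith R).Structure M]

/-- the value of `0` -/
def zeroOp : M := Structure.funMap (L := arithWith R) ArithFunc.zero ![]

/-- the value of `S x` -/
def succOp (x : M) : M := Structure.funMap (L := arithWith R) ArithFunc.succ ![x]

/-- the value of `x + y` -/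
def addOp (x y : M) : M := Structure.funMap (L := arithWith R) ArithFunc.add ![x, y]

/-- the value of `x × y` -/
def mulOp (x y : M) : M := Structure.funMap (L := arithWith R) ArithFunc.mul ![x, y]

variable {R} {α : Type} (v : α → M)

@[simp] theorem realize_zero : (zero : (arithWith R).Term α).realize v = zeroOp R := by
  simp only [zero, Term.realize_func, zeroOp]
  congr 1
  exact Subsingleton.elim _ _

@[simp] theorem realize_succ (t : (arithWith R).Term α) :
    (succ t).realize v = succOp R (t.realize v) := by
  simp only [succ, Term.realize_func, succOp]
  congr 1
  funext i
  fin_cases i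
  rfl

@[simp] theorem realize_add (t u : (arithWith R).Term α) :
    (add t u).realize v = addOp R (t.realize v) (u.realize v) := by
  simp only [add, Term.realize_func, addOp]
  congr 1
  funext i
  fin_cases i <;> rfl

@[simp] theorem realize_mul (t u : (arithWith R).Term α) :
    (mul t u).realize v = mulOp R (t.realize v) (u.realize v) := by
  simp only [mul, Term.realize_func, mulOp]
  congr 1
  funext i
  fin_cases i <;> rfl

@[simp] theorem realize_numeral (n : ℕ) :
    (numeral n : (arithWith R).Term α).realize v =
      RobinsonMinus.num (zeroOp R) (succOp R) n := by
  induction n with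
  | zero => exact realize_zero v
  | succ n ih => rw [numeral, realize_succ, ih, RobinsonMinus.num_succ]

theorem models_robinsonMinus : M ⊨ robinsonMinus R ↔
    RobinsonMinus (zeroOp R : M) (succOp R) (addOp R) (mulOp R) := by
  simp only [robinsonMinus, Theory.model_iff, Set.mem_insert_iff, Set.mem_singleton_iff,
    forall_eq_or_imp, forall_eq, Sentence.Realize, Formula.Realize, BoundedFormula.realize_all,
    BoundedFormula.realize_imp, BoundedFormula.realize_not, BoundedFormula.realize_bdEqual,
    realize_succ, realize_zero, realize_add, realize_mul, Term.realize_var, Sum.elim_inr,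
    Function.comp_apply]
  constructor
  · rintro ⟨h1, h2, h4, h5, h6, h7⟩
    -- `Q₁` is stated contrapositively, so injectivity is recovered classically.
    exact ⟨fun x y hxy => by_contra fun hne => h1 x y hne hxy, h2, h4, h5, h6, h7⟩
  · rintro ⟨h1, h2, h4, h5, h6, h7⟩
    exact ⟨fun x y hne hxy => hne (h1 x y hxy), h2, h4, h5, h6, h7⟩

theorem realize_isLeNumeral (n : ℕ) (x : Fin 1 → M) (v : Empty → M) :
    (isLeNumeral (R := R) n).Realize v x ↔
      ∃ k ≤ n, x 0 = RobinsonMinus.num (zeroOp R) (succOp R) k := by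
  simp only [isLeNumeral, BoundedFormula.realize_iSup, BoundedFormula.realize_bdEqual,
    Term.realize_var, Sum.elim_inr, realize_numeral, Function.comp_apply]
  constructor
  · rintro ⟨k, hk⟩
    exact ⟨k, by lia, hk⟩
  · rintro ⟨k, hk, hx⟩
    exact ⟨⟨k, by lia⟩, hx⟩

end Operations

/-- the value of `x ≤ y` -/
def leOp {M : Type*} [arithLe.Structure M] (x y : M) : Prop :=
  Structure.RelMap (L := arithLe) LeRel.le ![x, y]

@[simp] theorem realize_le {M : Type*} [arithLe.Structure M] {α : Type} {n : ℕ} (v : α → M)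
    (x : Fin n → M) (t u : arithLe.Term (α ⊕ Fin n)) :
    (le t u).Realize v x ↔ leOp (t.realize (Sum.elim v x)) (u.realize (Sum.elim v x)) := by
  change Structure.RelMap (L := arithLe) LeRel.le
    (fun i => (![t, u] i).realize (Sum.elim v x)) ↔ _
  rw [leOp]
  refine iff_of_eq (congrArg _ ?_)
  funext i
  fin_cases i <;> rfl

theorem models_theoryIQ {M : Type*} [arithLe.Structure M] : M ⊨ theoryIQ ↔
    RobinsonMinus (zeroOp LeRel : M) (succOp LeRel) (addOp LeRel) (mulOp LeRel) ∧
      ∀ n (x : M), leOp x (RobinsonMinus.num (zeroOp LeRel) (succOp LeRel) n) ↔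
        ∃ k ≤ n, x = RobinsonMinus.num (zeroOp LeRel) (succOp LeRel) k := by
  rw [theoryIQ, Theory.model_union_iff, models_robinsonMinus]
  refine and_congr_right fun _ => ?_
  simp only [Theory.model_iff, Set.forall_mem_range, Sentence.Realize, Formula.Realize,
    BoundedFormula.realize_all, BoundedFormula.realize_iff, realize_le, realize_isLeNumeral,
    realize_numeral, Term.realize_var, Sum.elim_inr, Function.comp_apply]
  exact Iff.rfl

theorem models_theoryIQStar {M : Type*} [arith.Structure M] : M ⊨ theoryIQStar ↔
    RobinsonMinus (zeroOp (fun _ => Empty) : M) (succOp fun _ => Empty)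
      (addOp fun _ => Empty) (mulOp fun _ => Empty) ∧
      ∀ n (x : M), (∃ w, addOp (fun _ => Empty) w x =
          RobinsonMinus.num (zeroOp fun _ => Empty) (succOp fun _ => Empty) n) →
        ∃ k ≤ n, x = RobinsonMinus.num (zeroOp fun _ => Empty) (succOp fun _ => Empty) k := by
  rw [theoryIQStar, Theory.model_union_iff, models_robinsonMinus]
  refine and_congr_right fun _ => ?_
  simp only [Theory.model_iff, Set.forall_mem_range, Sentence.Realize, Formula.Realize,
    BoundedFormula.realize_all, BoundedFormula.realize_imp, BoundedFormula.realize_ex,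
    BoundedFormula.realize_bdEqual, realize_add, realize_isLeNumeral,
    realize_numeral, Term.realize_var, Sum.elim_inr, Function.comp_apply]
  exact Iff.rfl

end Arith

/-! ### Definability of the cut -/

namespace Arith

/-- the formula `φ(t)` -/
def substTerm {L : FirstOrder.Language.{0, 0}} {α : Type} {n : ℕ} (φ : L.Formula (Fin 1))
    (t : L.Term (α ⊕ Fin n)) : L.BoundedFormula α n :=
  BoundedFormula.relabel (n := n) (k := 0) id (BoundedFormula.subst φ fun _ => t)

theorem realize_substTerm {L : FirstOrder.Language.{0, 0}} {M : Type*} [L.Structure M]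
    {α : Type} {n : ℕ} {φ : L.Formula (Fin 1)} {I : M → Prop}
    (hφ : ∀ v : Fin 1 → M, φ.Realize v ↔ I (v 0)) (t : L.Term (α ⊕ Fin n)) (v : α → M)
    (x : Fin n → M) : (substTerm φ t).Realize v x ↔ I (t.realize (Sum.elim v x)) := by
  refine BoundedFormula.realize_relabel.trans (BoundedFormula.realize_subst.trans ?_)
  rw [← hφ fun _ => t.realize (Sum.elim v x), Formula.Realize]
  -- The two sides differ only in the empty tuple of bound variables.
  exact iff_of_eq (congrArg _ (Subsingleton.elim _ _))

/-- the variable of a formula in one free variable -/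
abbrev freeVar {n : ℕ} : arithLe.Term (Fin 1 ⊕ Fin n) := Term.var (Sum.inl 0)

/-- the formula for `OrderStep` -/
def orderStepFormula : arithLe.Formula (Fin 1) :=
  le zero freeVar ⊓ ∀' ((freeVar =' succ (&0)) ⟹
    (le (&0) freeVar ⊓ ∀' (le (&1) (&0) ⟹ (le (&1) freeVar ⊓ le (succ (&1)) freeVar))))

/-- the formula for `OrderGood` -/
def orderGoodFormula : arithLe.Formula (Fin 1) :=
  orderStepFormula ⊓ ∀' (le (&0) freeVar ⟹ substTerm orderStepFormula (&0))

/-- the formula for `SummandLe` -/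
def summandLeFormula : arithLe.Formula (Fin 1) :=
  ∀' (substTerm orderGoodFormula (add (&0) freeVar) ⟹ le freeVar (add (&0) freeVar))

/-- the formula for `AddCut` -/
def addCutFormula (φ : arithLe.Formula (Fin 1)) : arithLe.Formula (Fin 1) :=
  φ ⊓ ((∀' ∀' (add (add (&0) (&1)) freeVar =' add (&0) (add (&1) freeVar))) ⊓
    ∀' (substTerm φ (&0) ⟹ substTerm φ (add (&0) freeVar)))

/-- the formula for `DistribCut` -/
def distribCutFormula (φ : arithLe.Formula (Fin 1)) : arithLe.Formula (Fin 1) :=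
  φ ⊓ ((∀' ∀' (substTerm φ (&0) ⟹
      (mul (&0) (add (&1) freeVar) =' add (mul (&0) (&1)) (mul (&0) freeVar)))) ⊓
    ∀' (substTerm φ (&0) ⟹ substTerm φ (mul (&0) freeVar)))

/-- the formula for `MulCut` -/
def mulCutFormula (φ ψ : arithLe.Formula (Fin 1)) : arithLe.Formula (Fin 1) :=
  ψ ⊓ ((∀' ∀' (substTerm φ (&0) ⟹ (substTerm ψ (&1) ⟹
      (mul (&0) (mul (&1) freeVar) =' mul (mul (&0) (&1)) freeVar)))) ⊓
    ∀' (substTerm ψ (&0) ⟹ substTerm ψ (mul (&0) freeVar)))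

/-- the formula for the cut generated by `SummandLe` -/
def cutFormula : arithLe.Formula (Fin 1) :=
  mulCutFormula (addCutFormula summandLeFormula)
    (distribCutFormula (addCutFormula summandLeFormula))

section Realize

variable {M : Type*} [arithLe.Structure M] {v : Fin 1 → M} {φ ψ : arithLe.Formula (Fin 1)}
  {I J : M → Prop}

theorem realize_orderStepFormula : orderStepFormula.Realize v ↔
    OrderStep (zeroOp LeRel) (succOp LeRel) leOp (v 0) := by
  simp [orderStepFormula, OrderStep, Formula.Realize, Fin.snoc]

theorem realize_orderGoodFormula : orderGoodFormula.Realize v ↔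
    OrderGood (zeroOp LeRel) (succOp LeRel) leOp (v 0) := by
  rw [orderGoodFormula, Formula.realize_inf, realize_orderStepFormula]
  simp [OrderGood, Formula.Realize, Fin.snoc,
    realize_substTerm fun v : Fin 1 → M => realize_orderStepFormula (v := v)]

theorem realize_summandLeFormula : summandLeFormula.Realize v ↔
    SummandLe (zeroOp LeRel) (succOp LeRel) (addOp LeRel) leOp (v 0) := by
  simp [summandLeFormula, SummandLe, Formula.Realize, Fin.snoc,
    realize_substTerm fun v : Fin 1 → M => realize_orderGoodFormula (v := v)]

theorem realize_addCutFormula (hφ : ∀ v : Fin 1 → M, φ.Realize v ↔ I (v 0)) :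
    (addCutFormula φ).Realize v ↔ AddCut (addOp LeRel) I (v 0) := by
  rw [addCutFormula, Formula.realize_inf, hφ]
  simp only [Formula.Realize, BoundedFormula.realize_inf, BoundedFormula.realize_all,
    BoundedFormula.realize_imp, BoundedFormula.realize_bdEqual, realize_substTerm hφ]
  simp [Fin.snoc]
  exact ⟨fun h => ⟨h.1, h.2.1, h.2.2⟩, fun h => ⟨h.mem, h.assoc, h.add_mem⟩⟩

theorem realize_distribCutFormula (hφ : ∀ v : Fin 1 → M, φ.Realize v ↔ I (v 0)) :
    (distribCutFormula φ).Realize v ↔ DistribCut (addOp LeRel) (mulOp LeRel) I (v 0) := by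
  rw [distribCutFormula, Formula.realize_inf, hφ]
  simp only [Formula.Realize, BoundedFormula.realize_inf, BoundedFormula.realize_all,
    BoundedFormula.realize_imp, BoundedFormula.realize_bdEqual, realize_substTerm hφ]
  simp [Fin.snoc]
  exact ⟨fun h => ⟨h.1, h.2.1, h.2.2⟩, fun h => ⟨h.mem, h.distrib, h.mul_mem⟩⟩

theorem realize_mulCutFormula (hφ : ∀ v : Fin 1 → M, φ.Realize v ↔ I (v 0))
    (hψ : ∀ v : Fin 1 → M, ψ.Realize v ↔ J (v 0)) :
    (mulCutFormula φ ψ).Realize v ↔ MulCut (mulOp LeRel) I J (v 0) := by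
  rw [mulCutFormula, Formula.realize_inf, hψ]
  simp only [Formula.Realize, BoundedFormula.realize_inf, BoundedFormula.realize_all,
    BoundedFormula.realize_imp, BoundedFormula.realize_bdEqual, realize_substTerm hφ,
    realize_substTerm hψ]
  simp [Fin.snoc]
  exact ⟨fun h => ⟨h.1, h.2.1, h.2.2⟩, fun h => ⟨h.mem, h.assoc, h.mul_mem⟩⟩

theorem realize_cutFormula : cutFormula.Realize v ↔
    Cut (addOp LeRel) (mulOp LeRel)
      (SummandLe (zeroOp LeRel : M) (succOp LeRel) (addOp LeRel) leOp) (v 0) := by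
  have h (v : Fin 1 → M) := realize_addCutFormula (v := v) fun _ => realize_summandLeFormula
  exact realize_mulCutFormula h fun v => realize_distribCutFormula h

end Realize

end Arith

/-! ### The two interpretations -/

namespace Arith

/-- the formula `∃ z, z + x = y` -/
def leFormula : ∀ {n : ℕ}, LeRel n → arith.Formula (Fin n × Fin 1)
  | _, .le => ∃' (add (&0) (Term.var (Sum.inl (0, 0))) =' Term.var (Sum.inl (1, 0)))

theorem freeVarFinset_leFormula {n : ℕ} (r : LeRel n) :
    (leFormula r).freeVarFinset = Finset.univ := by
  cases r
  ext ⟨i, j⟩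
  rw [Subsingleton.elim j 0]
  simp only [Finset.mem_univ, iff_true]
  change _ ∈ (((Finset.univ.biUnion fun i : Fin 2 => Term.varFinsetLeft _) ∪ {((1 : Fin 2), (0 : Fin 1))}) ∪ ∅) ∪ ∅
  fin_cases i <;> simp [Fin.exists_fin_two]

theorem map_funMap {R₁ R₂ : ℕ → Type} {M N : Type*} [(arithWith R₂).Structure M]
    [(arithWith R₁).Structure N] {e : N → M} (hz : e (zeroOp R₁) = zeroOp R₂)
    (hs : ∀ x, e (succOp R₁ x) = succOp R₂ (e x))
    (ha : ∀ x y, e (addOp R₁ x y) = addOp R₂ (e x) (e y))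
    (hm : ∀ x y, e (mulOp R₁ x y) = mulOp R₂ (e x) (e y)) {n : ℕ} (f : ArithFunc n)
    (x : Fin n → N) : e (Structure.funMap (L := arithWith R₁) f x) =
      Structure.funMap (L := arithWith R₂) f fun i => e (x i) := by
  -- This replaces an arbitrary argument tuple by the explicit `![…]` form in which the operations
  -- are defined.
  have key {k : ℕ} {f : ArithFunc k} {x : Fin k → N} (y : Fin k → N) (w : Fin k → M) (hx : x = y)
      (hw : w = fun i => e (x i)) (hf : e (Structure.funMap (L := arithWith R₁) f y) =
        Structure.funMap (L := arithWith R₂) f w) :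
      e (Structure.funMap (L := arithWith R₁) f x) =
        Structure.funMap (L := arithWith R₂) f fun i => e (x i) := by
    rw [← hw, ← hf, hx]
  cases f with
  | zero => exact key _ _ (Subsingleton.elim _ _) (Subsingleton.elim _ _) hz
  | succ =>
    exact key ![x 0] ![e (x 0)] (funext <| Fin.forall_fin_one.2 rfl) (funext <| Fin.forall_fin_one.2 rfl) (hs (x 0))
  | add =>
    exact key ![x 0, x 1] ![e (x 0), e (x 1)] (funext <| Fin.forall_fin_two.2 ⟨rfl, rfl⟩)
      (funext <| Fin.forall_fin_two.2 ⟨rfl, rfl⟩) (ha (x 0) (x 1))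
  | mul =>
    exact key ![x 0, x 1] ![e (x 0), e (x 1)] (funext <| Fin.forall_fin_two.2 ⟨rfl, rfl⟩)
      (funext <| Fin.forall_fin_two.2 ⟨rfl, rfl⟩) (hm (x 0) (x 1))

/-- A theory is interpretable if a model of it, with the inherited operations, is uniformly definable
in the models of the other one. -/
theorem interpretable_of_inner_models {R₁ R₂ : ℕ → Type} (dom : (arithWith R₂).Formula (Fin 1))
    (dom_free : 0 ∈ dom.freeVarFinset)
    (rel : ∀ {n : ℕ}, R₁ n → (arithWith R₂).Formula (Fin n × Fin 1))
    (rel_free : ∀ {n : ℕ} (r : R₁ n), (rel r).freeVarFinset = Finset.univ)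
    {S : (arithWith R₁).Theory} {T : (arithWith R₂).Theory}
    (H : ∀ (M : Type) [(arithWith R₂).Structure M], M ⊨ T →
      ∃ (N : Type) (_ : (arithWith R₁).Structure N) (e : N → M),
        Function.Injective e ∧ (∀ v, dom.Realize v ↔ ∃ x, e x = v 0) ∧
        (∀ {n : ℕ} (r : R₁ n) (x : Fin n → N), (rel r).Realize (fun p => e (x p.1)) ↔
          Structure.RelMap (L := arithWith R₁) r x) ∧
        e (zeroOp R₁) = zeroOp R₂ ∧ (∀ x, e (succOp R₁ x) = succOp R₂ (e x)) ∧
        (∀ x y, e (addOp R₁ x y) = addOp R₂ (e x) (e y)) ∧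
        (∀ x y, e (mulOp R₁ x y) = mulOp R₂ (e x) (e y)) ∧ N ⊨ S) :
    Interpretable S T := by
  refine ⟨arithTranslation dom dom_free rel rel_free,
    RelTranslation.isInterpretation_of_isInnerModel (arithTranslation_eqAsEq _ _ _ _)
      fun M _ _ hM => ?_⟩
  obtain ⟨N, hN, e, he, hdom, hrel, hz, hs, ha, hm, hS⟩ := H M hM
  exact ⟨N, hN, ⟨zeroOp R₁⟩, fun x _ => e x, fun x y hxy => he (congrFun hxy (0 : Fin 1)),
    arithTranslation_isInnerModel dom dom_free rel rel_free he hdom hrel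
      (map_funMap hz hs ha hm), hS⟩

theorem interpretable_theoryIQ_theoryIQStar : Interpretable theoryIQ theoryIQStar := by
  -- The domain `x = x` is everything, yet contains the free variable that a translation must have.
  refine interpretable_of_inner_models ((Term.var 0 : arith.Term (Fin 1)).equal (Term.var 0))
    (by simp [freeVarFinset_equal]) leFormula freeVarFinset_leFormula fun M _ hM => ?_
  obtain ⟨hQ, hle⟩ := models_theoryIQStar.1 hM
  let N : arithLe.Structure M := arithStructure (zeroOp fun _ => Empty) (succOp fun _ => Empty)
    (addOp fun _ => Empty) (mulOp fun _ => Empty) fun r x => (leFormula r).Realize fun p => x p.1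
  refine ⟨M, N, id, Function.injective_id, fun v => by simp [Formula.realize_equal], fun r x => Iff.rfl,
    rfl, fun _ => rfl, fun _ _ => rfl, fun _ _ => rfl, models_theoryIQ.2 ⟨hQ, fun n x => ?_⟩⟩
  refine Iff.trans (b := ∃ w, addOp (fun _ => Empty) w x =
    num (zeroOp fun _ => Empty) (succOp fun _ => Empty) n) ?_ ⟨hle n x, ?_⟩
  · change (leFormula LeRel.le).Realize _ ↔ _
    simp [leFormula, Formula.Realize, Fin.snoc]
    rfl
  · rintro ⟨k, hk, rfl⟩
    -- The witness is the numeral of `n - k`.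
    exact ⟨_, (hQ.num_add (n - k) k).trans (by rw [Nat.sub_add_cancel hk])⟩

/-- The elements of a cut form a structure for the language of arithmetic. -/
@[reducible] def cutStructure {M : Type*} {z : M} {s : M → M} {a m : M → M → M} {I : M → Prop}
    (h : RobinsonMinus z s a m) (hI : Inductive z s I) :
    arith.Structure {x // Cut a m I x} :=
  arithStructure ⟨z, (h.inductive_cut hI).zero_mem⟩
    (fun x => ⟨s x, (h.inductive_cut hI).succ_mem x x.2⟩) (fun x y => ⟨a x y, cut_add x.2 y.2⟩)
    (fun x y => ⟨m x y, cut_mul x.2 y.2⟩) fun r _ => r.elim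

/-- The axioms kept from `Q` are universal, so they restrict to the cut; only the schema uses
`hnum`. -/
theorem models_theoryIQStar_cutStructure {M : Type*} {z : M} {s : M → M} {a m : M → M → M}
    {I : M → Prop} (h : RobinsonMinus z s a m) (hI : Inductive z s I)
    (hnum : ∀ n x y, I y → a x y = num z s n → ∃ k ≤ n, y = num z s k) :
    let _ := cutStructure h hI
    {x // Cut a m I x} ⊨ theoryIQStar := by
  intro _
  refine models_theoryIQStar.2 ⟨⟨?_, ?_, ?_, ?_, ?_, ?_⟩, ?_⟩
  · exact fun x y hxy => Subtype.ext (h.succ_inj _ _ (congrArg Subtype.val hxy))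
  · exact fun x hx => h.succ_ne_zero _ (congrArg Subtype.val hx)
  · exact fun x => Subtype.ext (h.add_zero _)
  · exact fun x y => Subtype.ext (h.add_succ _ _)
  · exact fun x => Subtype.ext (h.mul_zero _)
  · exact fun x y => Subtype.ext (h.mul_succ _ _)
  · rintro n x ⟨w, hw⟩
    have hval : ∀ k, (num (zeroOp fun _ => Empty) (succOp fun _ => Empty) k :
        {x // Cut a m I x}).1 = num z s k := by
      intro k
      induction k with
      | zero => rfl
      | succ k ih => rw [num_succ, num_succ, ← ih]; rfl
    -- The three projections descend through `MulCut`, `DistribCut` and `AddCut` to `I`.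
    obtain ⟨k, hk, hx⟩ := hnum n w x x.2.mem.mem.mem ((congrArg Subtype.val hw).trans (hval n))
    exact ⟨k, hk, Subtype.ext (hx.trans (hval k).symm)⟩

/-- The harmless conjunct `x = x` secures the free variable without computing those of the large cut
formula. -/
theorem mem_freeVarFinset_inf_equal (φ : arithLe.Formula (Fin 1)) : 0 ∈ (φ ⊓
    (Term.var 0 : arithLe.Term (Fin 1)).equal (Term.var 0)).freeVarFinset := by
  refine mem_freeVarFinset_inf_right _ _ ?_
  simp [freeVarFinset_equal]

/-- The cut generated by `SummandLe` yields an interpretation, whichever formula defines it. -/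
theorem interpretable_of_realize_cut (φ : arithLe.Formula (Fin 1))
    (hφ : ∀ (M : Type) [arithLe.Structure M] (v : Fin 1 → M), φ.Realize v ↔
      Cut (addOp LeRel) (mulOp LeRel)
        (SummandLe (zeroOp LeRel : M) (succOp LeRel) (addOp LeRel) leOp) (v 0)) :
    Interpretable theoryIQStar theoryIQ := by
  -- The domain left open is `φ` together with `x = x`, as fixed by the next argument.
  refine interpretable_of_inner_models (R₁ := fun _ => Empty) (R₂ := LeRel) _
    (mem_freeVarFinset_inf_equal φ) (fun r => r.elim) (fun r => r.elim) fun M _ hM => ?_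
  obtain ⟨hQ, hle⟩ := models_theoryIQ.1 hM
  have hI := inductive_summandLe (r := leOp) hQ
  refine ⟨_, cutStructure hQ hI, Subtype.val, Subtype.val_injective, fun v => ?_,
    fun r => r.elim, rfl, fun _ => rfl, fun _ _ => rfl, fun _ _ => rfl,
    models_theoryIQStar_cutStructure hQ hI fun n x y hy hx => hy.exists_num hQ hle hx⟩
  rw [Formula.realize_inf, hφ]
  simp [Formula.realize_equal]

theorem interpretable_theoryIQStar_theoryIQ : Interpretable theoryIQStar theoryIQ :=
  interpretable_of_realize_cut cutFormula fun _ _ _ => realize_cutFormula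

end Arith

theorem mainTheorem4 : MutuallyInterpretable theoryIQ theoryIQStar :=
  ⟨Arith.interpretable_theoryIQ_theoryIQStar, Arith.interpretable_theoryIQStar_theoryIQ⟩
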